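/- Let $\mathcal X$ be a Polish space with its Borel $\sigma$-algebra, and let $\mathcal P$ be the set of Borel probability measures on $\mathcal X$ with the topology of weak convergence. Let $P,Q\in\mathcal P$, and let $x_1,x_2,\dots$ be i.i.d. with law $P$ and $y_1,y_2,\dots$ be i.i.d. with law $Q$, the two sequences being independent of each other. For $n,m\ge 1$ let $\hat P_n=\frac1n\sum_{i=1}^n\delta_{x_i}$ and $\hat Q_m=\frac1m\sum_{i=1}^m\delta_{y_i}$ be the empirical measures. Let $n,m\to\infty$ along an arbitrary sequence of pairs of positive integers (or, more generally, along an arbitrary filter) such that $\frac{n}{n+m}\to c$ with $0<c<1$. Then for every set $\Gamma\subset\mathcal P\times\mathcal P$, $$\limsup_{n,m\to\infty}-\frac{1}{n+m}\log\Pr\big((\hat P_n,\hat Q_m)\in\Gamma\big)\;\le\;\inf_{(R,S)\in\operatorname{int}\Gamma}\big(c\,D(R\|P)+(1-c)\,D(S\|Q)\big),$$ $$\liminf_{n,m\to\infty}-\frac{1}{n+m}\log\Pr\big((\hat P_n,\hat Q_m)\in\Gamma\big)\;\ge\;\inf_{(R,S)\in\operatorname{cl}\Gamma}\big(c\,D(R\|P)+(1-c)\,D(S\|Q)\big),$$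 where $\operatorname{int}$ and $\operatorname{cl}$ are taken in the product topology on $\mathcal P\times\mathcal P$, and $D(R\|P)\in[0,\infty]$ is the Kullback–Leibler divergence, i.e. $\int\log\frac{dR}{dP}\,dR$ if $R\ll P$ and $+\infty$ otherwise. Here $\log 0=-\infty$ and $\inf\varnothing=+\infty$, so all quantities are extended reals; if the event is not measurable, $\Pr$ denotes outer probability. -/

import Mathlib

open MeasureTheory ProbabilityTheory InformationTheory Filter Topology
open scoped ENNReal

/-- The empirical measure `(1/n) ∑_{i < n} δ_{z i}` of the first `n ≥ 1` terms of the sequence `z`,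
as a probability measure. -/
noncomputable def empiricalMeasure {X : Type*} [MeasurableSpace X] (n : ℕ+) (z : ℕ → X) :
    ProbabilityMeasure X :=
  ⟨((n : ℕ) : ℝ≥0∞)⁻¹ • ∑ i ∈ Finset.range n, Measure.dirac (z i), ⟨by
    simp only [Measure.smul_apply, Measure.finsetSum_apply, measure_univ, smul_eq_mul,
      Finset.sum_const, Finset.card_range, nsmul_eq_mul, mul_one]
    exact ENNReal.inv_mul_cancel (Nat.cast_ne_zero.mpr n.ne_zero) (ENNReal.natCast_ne_top _)⟩⟩

/-- The rate `c D(R‖P) + (1 - c) D(S‖Q)` of a pair `(R, S)`, with values in `[0, ∞]`. -/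
noncomputable def pairRate {X : Type*} [MeasurableSpace X] (c : ℝ) (P Q : ProbabilityMeasure X)
    (p : ProbabilityMeasure X × ProbabilityMeasure X) : ℝ≥0∞ :=
  ENNReal.ofReal c * klDiv (p.1 : Measure X) (P : Measure X)
    + ENNReal.ofReal (1 - c) * klDiv (p.2 : Measure X) (Q : Measure X)

/-- The normalized exponent `-(1 / (n + m)) log Pr((P̂ₙ, Q̂ₘ) ∈ Γ)`, where `P̂ₙ` and `Q̂ₘ` are the
empirical measures of the first `n` terms of `x` and the first `m` terms of `y`. It takes values in
the extended reals, and is `+∞` when the probability is zero. -/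
noncomputable def empiricalExponent {Ω X : Type*} [MeasurableSpace Ω] [MeasurableSpace X]
    (μ : Measure Ω) (x y : ℕ → Ω → X)
    (Γ : Set (ProbabilityMeasure X × ProbabilityMeasure X)) (n m : ℕ+) : EReal :=
  ((-(1 / (((n : ℕ) : ℝ) + ((m : ℕ) : ℝ))) : ℝ) : EReal) *
    ENNReal.log (μ {ω | (empiricalMeasure n (fun i => x i ω),
      empiricalMeasure m (fun i => y i ω)) ∈ Γ})

/-! Upper bound on probabilities: the divergence is the supremum over bounded continuous `f` of `∫ f
dS - ∫ (exp f - 1) dP`, a variant of the Donsker–Varadhan formula without logarithm. If the rate of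
a pair exceeds `a`, two test functions `f`, `g` witness it. They cut out a product of two
half-spaces around the pair, whose probability is at most `exp (-(n + m) a)` by Chernoff's bound on
each sample and independence of the samples (`exists_nhds_measure_empiricalMeasure_mem_le`).
Finitely many such neighbourhoods cover a compact part of the closure, and exponential tightness
(`exists_isCompact_measure_empiricalMeasure_notMem_le`) makes the rest negligible.

Lower bound on probabilities: for `(R, S)` in the interior, replace `P` by `R` and `Q` by `S`. Under
the new laws the empirical measures converge, and by the law of large numbers for the log-likelihood
ratio the change of measure costs about `exp (-n D(R‖P))` and `exp (-m D(S‖Q))`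
(`exists_measurableSet_infinitePi_ge`).

The event of `Γ` itself need not be measurable: it is only compared with other events by
monotonicity and subadditivity of outer measure, and independence is applied to measurable events
alone. -/

open scoped BoundedContinuousFunction

/-! ### Dual variational formula for the divergence -/

/-- The functional `∫ f dS - ∫ (exp f - 1) dP`, whose supremum over `f` is the Kullback-Leibler
divergence of `S` from `P`. -/
noncomputable def dualKL {X : Type*} [MeasurableSpace X] (P S : Measure X) (f : X → ℝ) : ℝ :=
  ∫ x, f x ∂S - ∫ x, (Real.exp (f x) - 1) ∂P

lemma integrable_of_bounded {X : Type*} [MeasurableSpace X] {P : Measure X} [IsFiniteMeasure P]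
    {f : X → ℝ} (hf : Measurable f) {C : ℝ} (hC : ∀ x, |f x| ≤ C) : Integrable f P :=
  Integrable.of_bound hf.aestronglyMeasurable C (ae_of_all _ fun x => by simpa using hC x)

lemma integrable_exp_sub_one_of_bounded {X : Type*} [MeasurableSpace X] {P : Measure X}
    [IsFiniteMeasure P] {f : X → ℝ} (hf : Measurable f) {C : ℝ} (hC : ∀ x, |f x| ≤ C) :
    Integrable (fun x => Real.exp (f x) - 1) P := by
  refine (Integrable.of_bound (hf.exp.aestronglyMeasurable) (Real.exp C)
    (ae_of_all _ fun x => ?_)).sub (integrable_const 1)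
  rw [Real.norm_eq_abs, Real.abs_exp]
  exact Real.exp_le_exp.2 ((le_abs_self _).trans (hC x))

lemma abs_exp_sub_exp_le {a b K : ℝ} (ha : a ≤ K) (hb : b ≤ K) :
    |Real.exp a - Real.exp b| ≤ Real.exp K * |a - b| := by
  wlog h : b ≤ a generalizing a b
  · rw [abs_sub_comm, abs_sub_comm a]
    exact this hb ha (le_of_not_ge h)
  rw [abs_of_nonneg (sub_nonneg.2 (Real.exp_le_exp.2 h)), abs_of_nonneg (sub_nonneg.2 h)]
  have h1 : Real.exp b = Real.exp a * Real.exp (b - a) := by rw [← Real.exp_add]; ring_nf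
  have h2 : b - a + 1 ≤ Real.exp (b - a) := Real.add_one_le_exp _
  have h3 : Real.exp a ≤ Real.exp K := Real.exp_le_exp.2 ha
  have h4 := Real.exp_pos a
  calc Real.exp a - Real.exp b = Real.exp a * (1 - Real.exp (b - a)) := by rw [h1]; ring
    _ ≤ Real.exp a * (a - b) := mul_le_mul_of_nonneg_left (by linarith) h4.le
    _ ≤ Real.exp K * (a - b) := mul_le_mul_of_nonneg_right h3 (by linarith)

/-- Bounded measurable functions can be replaced by bounded continuous ones in `dualKL`. -/
lemma exists_boundedContinuous_dualKL_ge {X : Type*} [TopologicalSpace X] [PolishSpace X]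
    [MeasurableSpace X] [BorelSpace X] (P S : Measure X) [IsProbabilityMeasure P]
    [IsProbabilityMeasure S] {f : X → ℝ} (hf : Measurable f) {K : ℝ} (hK : ∀ x, |f x| ≤ K)
    {b : ℝ} (hb : b < dualKL P S f) : ∃ g : X →ᵇ ℝ, b < dualKL P S g := by
  let := TopologicalSpace.upgradeIsCompletelyMetrizable X
  set ε : ℝ := (dualKL P S f - b) / (2 * (1 + Real.exp K)) with hε
  have hexp := Real.exp_pos K
  have hεpos : 0 < ε := div_pos (by linarith) (by linarith)
  -- Approximating in `L¹(P + S)` gives one function close to `f` for both measures.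
  have hfi : Integrable f (P + S) := integrable_of_bounded hf hK
  obtain ⟨g₀, hg₀, hg₀i⟩ := hfi.exists_boundedContinuous_integral_sub_le hεpos
  have hX : Nonempty X := by
    by_contra h
    rw [not_nonempty_iff] at h
    have h1 : P Set.univ = 1 := measure_univ
    simp [Set.eq_empty_of_isEmpty] at h1
  have hK0 : 0 ≤ K := (abs_nonneg _).trans (hK hX.some)
  -- Clamping to `[-K, K]` is 1-Lipschitz and fixes `f`, so the `L¹` error does not grow, while
  -- `exp` becomes `exp K`-Lipschitz on the range. This explains the factor `1 + exp K` in `ε`.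
  have hgb : ∀ x, |max (-K) (min K (g₀ x))| ≤ K := fun x =>
    abs_le.2 ⟨le_max_left _ _, max_le (by linarith) (min_le_left _ _)⟩
  let g : X →ᵇ ℝ := BoundedContinuousFunction.ofNormedAddCommGroup
    (fun x => max (-K) (min K (g₀ x))) (by fun_prop) K hgb
  have hgm : Measurable g := g.continuous.measurable
  have hgK : ∀ x, |g x| ≤ K := hgb
  have hclose : ∀ x, |f x - g x| ≤ ‖f x - g₀ x‖ := by
    intro x
    have h1 : f x = max (-K) (min K (f x)) := by
      rw [min_eq_right (abs_le.1 (hK x)).2, max_eq_right (abs_le.1 (hK x)).1]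
    have h2 : g x = max (-K) (min K (g₀ x)) := rfl
    rw [h2, Real.norm_eq_abs]
    conv_lhs => rw [h1]
    rw [min_comm K, min_comm K, max_comm (-K), max_comm (-K)]
    exact (abs_max_sub_max_le_abs _ _ _).trans (abs_inf_sub_inf_le_abs _ _ _)
  have hint : ∀ μ : Measure X, IsFiniteMeasure μ → Integrable (fun x => |f x - g x|) μ :=
    fun μ _ => ((integrable_of_bounded hf hK).sub (integrable_of_bounded hgm hgK)).abs
  have hsum : ∫ x, |f x - g x| ∂P + ∫ x, |f x - g x| ∂S ≤ ε := by
    rw [← integral_add_measure (hint P inferInstance) (hint S inferInstance)]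
    exact (integral_mono (hint _ inferInstance) (hfi.sub hg₀i).norm hclose).trans hg₀
  have hP0 : 0 ≤ ∫ x, |f x - g x| ∂P := integral_nonneg fun _ => abs_nonneg _
  have hR0 : 0 ≤ ∫ x, |f x - g x| ∂S := integral_nonneg fun _ => abs_nonneg _
  have hR : ∫ x, f x ∂S - ∫ x, g x ∂S ≤ ∫ x, |f x - g x| ∂S := by
    rw [← integral_sub (integrable_of_bounded hf hK) (integrable_of_bounded hgm hgK)]
    exact (le_abs_self _).trans abs_integral_le_integral_abs
  have hP : ∫ x, (Real.exp (g x) - 1) ∂P - ∫ x, (Real.exp (f x) - 1) ∂P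
      ≤ Real.exp K * ∫ x, |f x - g x| ∂P := by
    rw [← integral_sub (integrable_exp_sub_one_of_bounded hgm hgK)
      (integrable_exp_sub_one_of_bounded hf hK), ← integral_const_mul]
    refine integral_mono ((integrable_exp_sub_one_of_bounded hgm hgK).sub
      (integrable_exp_sub_one_of_bounded hf hK)) ((hint P inferInstance).const_mul _) fun x => ?_
    have := abs_exp_sub_exp_le ((le_abs_self _).trans (hgK x)) ((le_abs_self _).trans (hK x))
    rw [abs_sub_comm (g x)] at this
    have h2 := le_abs_self (Real.exp (g x) - Real.exp (f x))
    simp only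
    linarith
  refine ⟨g, ?_⟩
  have hε2 : (1 + Real.exp K) * ε = (dualKL P S f - b) / 2 := by
    rw [hε]; field_simp
  have : dualKL P S f - dualKL P S g ≤ (1 + Real.exp K) * ε := by
    unfold dualKL
    nlinarith
  linarith

/-- Truncation of a real number to the interval `[1 / (k + 1), k + 1]`. -/
noncomputable def truncRatio (k : ℕ) (t : ℝ) : ℝ := max (1 / ((k : ℝ) + 1)) (min ((k : ℝ) + 1) t)

lemma truncRatio_pos (k : ℕ) (t : ℝ) : 0 < truncRatio k t :=
  lt_max_of_lt_left (by positivity)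

lemma one_div_le_self_of_nat (k : ℕ) : 1 / ((k : ℝ) + 1) ≤ 1 :=
  (div_le_one (by positivity)).2 (by linarith [Nat.cast_nonneg (α := ℝ) k])

lemma truncRatio_le (k : ℕ) (t : ℝ) : truncRatio k t ≤ k + 1 :=
  max_le ((one_div_le_self_of_nat k).trans (by linarith [Nat.cast_nonneg (α := ℝ) k]))
    (min_le_left _ _)

lemma measurable_truncRatio (k : ℕ) : Measurable (truncRatio k) := by
  unfold truncRatio; fun_prop

lemma abs_log_truncRatio_le (k : ℕ) (t : ℝ) : |Real.log (truncRatio k t)| ≤ Real.log (k + 1) := by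
  refine abs_le.2 ⟨?_, Real.log_le_log (truncRatio_pos k t) (truncRatio_le k t)⟩
  rw [← Real.log_inv, ← one_div]
  exact Real.log_le_log (by positivity) (le_max_left _ _)

/-- With `c` the truncation of `t`, the expression is `klFun c + (t - c) * log c`. Truncation moves
`t` towards `1`, so `t - c` and `log c` have the same sign. This positivity is what Fatou's lemma
needs later. -/
lemma mul_log_truncRatio_nonneg (k : ℕ) (t : ℝ) :
    0 ≤ t * Real.log (truncRatio k t) - truncRatio k t + 1 := by
  set c := truncRatio k t with hc
  have hcpos : 0 < c := truncRatio_pos k t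
  have h1 : 0 ≤ klFun c := klFun_nonneg hcpos.le
  rw [klFun_apply] at h1
  have h2 : 0 ≤ (t - c) * Real.log c := by
    have hk := Nat.cast_nonneg (α := ℝ) k
    rcases le_total 1 t with h | h
    · have hct : c ≤ t := max_le ((one_div_le_self_of_nat k).trans h) (min_le_right _ _)
      have h1c : 1 ≤ c := le_max_of_le_right (le_min (by linarith) h)
      exact mul_nonneg (by linarith) (Real.log_nonneg h1c)
    · have hct : t ≤ c := le_max_of_le_right (le_min (by linarith) le_rfl)
      have h1c : c ≤ 1 := max_le (one_div_le_self_of_nat k) ((min_le_right _ _).trans h)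
      exact mul_nonneg_of_nonpos_of_nonpos (by linarith) (Real.log_nonpos hcpos.le h1c)
  linarith

lemma tendsto_mul_log_truncRatio {t : ℝ} (ht : 0 ≤ t) :
    Tendsto (fun k => t * Real.log (truncRatio k t) - truncRatio k t + 1) atTop
      (𝓝 (klFun t)) := by
  have hzero : Tendsto (fun k : ℕ => 1 / ((k : ℝ) + 1)) atTop (𝓝 0) :=
    tendsto_one_div_add_atTop_nhds_zero_nat
  rcases ht.eq_or_lt with rfl | hpos
  · have h : ∀ k : ℕ, truncRatio k 0 = 1 / ((k : ℝ) + 1) := fun k => by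
      unfold truncRatio
      rw [min_eq_right (by positivity), max_eq_left (by positivity)]
    simp only [h, zero_mul, klFun_zero]
    simpa using (hzero.const_sub 0).add_const 1
  · refine tendsto_const_nhds.congr' ?_
    filter_upwards [hzero.eventually_le_const hpos,
      (tendsto_natCast_atTop_atTop (R := ℝ)).eventually_ge_atTop t] with k hk1 hk2
    have h : truncRatio k t = t := by
      unfold truncRatio
      rw [min_eq_right (by linarith), max_eq_right hk1]
    rw [h, klFun_apply]; ring

/-- If `dualKL` is bounded by `M` on bounded measurable functions, so is the divergence. -/
lemma klDiv_le_of_forall_dualKL_le {X : Type*} [MeasurableSpace X] (P S : Measure X)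
    [IsProbabilityMeasure P] [IsProbabilityMeasure S] {M : ℝ}
    (hM : ∀ f : X → ℝ, Measurable f → (∃ K, ∀ x, |f x| ≤ K) → dualKL P S f ≤ M) :
    klDiv S P ≤ ENNReal.ofReal M := by
  have hac : S ≪ P := by
    refine Measure.AbsolutelyContinuous.mk fun A hA hPA => ?_
    by_contra hRA
    have hpos : 0 < S.real A := ENNReal.toReal_pos hRA (measure_ne_top S A)
    -- If `P A = 0 < S A`, the function `t` on `A` costs nothing under `P` and integrates to `|M| +
    -- 1 > M` under `S`.
    set t : ℝ := (|M| + 1) / S.real A with ht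
    have ht0 : 0 ≤ t := by positivity
    have h := hM (A.indicator fun _ => t) (measurable_const.indicator hA) ⟨t, fun x => by
      by_cases hx : x ∈ A <;> simp [hx, ht0, abs_of_nonneg]⟩
    have h1 : ∫ x, A.indicator (fun _ => t) x ∂S = |M| + 1 := by
      rw [integral_indicator_const _ hA, smul_eq_mul, ht]; field_simp
    have h2 : ∫ x, (Real.exp (A.indicator (fun _ => t) x) - 1) ∂P = 0 := by
      rw [integral_congr_ae (g := fun _ => (0 : ℝ))]
      · simp
      · have : ∀ᵐ x ∂P, x ∉ A := measure_eq_zero_iff_ae_notMem.1 hPA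
        filter_upwards [this] with x hx
        simp [hx]
    rw [dualKL, h1, h2] at h
    linarith [le_abs_self M]
  set r : X → ℝ := fun x => (S.rnDeriv P x).toReal with hr
  have hrm : Measurable r := (Measure.measurable_rnDeriv S P).ennreal_toReal
  have hr0 : ∀ x, 0 ≤ r x := fun x => ENNReal.toReal_nonneg
  set φ : ℕ → X → ℝ := fun k x =>
    r x * Real.log (truncRatio k (r x)) - truncRatio k (r x) + 1 with hφ
  have htm : ∀ k, Measurable fun x => truncRatio k (r x) := fun k =>
    (measurable_truncRatio k).comp hrm
  have hφm : ∀ k, Measurable (φ k) := fun k =>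
    ((hrm.mul (htm k).log).sub (htm k)).add_const 1
  have hφint : ∀ k, ∫⁻ x, ENNReal.ofReal (φ k x) ∂P ≤ ENNReal.ofReal M := by
    intro k
    have hlm : Measurable fun x => Real.log (truncRatio k (r x)) := (htm k).log
    have hlb : ∀ x, |Real.log (truncRatio k (r x))| ≤ Real.log (k + 1) :=
      fun x => abs_log_truncRatio_le k _
    have hi1 : Integrable (fun x => r x * Real.log (truncRatio k (r x))) P :=
      Measure.integrable_toReal_rnDeriv.mul_bdd (c := Real.log (k + 1)) hlm.aestronglyMeasurable
        (ae_of_all _ hlb)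
    have hi2 : Integrable (fun x => truncRatio k (r x) - 1) P := by
      have := integrable_exp_sub_one_of_bounded (P := P) hlm hlb
      simpa only [Real.exp_log (truncRatio_pos k _)] using this
    -- The test function is the log of the truncated density; the optimal choice `log (dS/dP)` need
    -- not be bounded.
    have heq : ∫ x, φ k x ∂P = dualKL P S fun x => Real.log (truncRatio k (r x)) := by
      have h1 : ∀ x, φ k x = r x * Real.log (truncRatio k (r x)) - (truncRatio k (r x) - 1) :=
        fun x => by simp only [hφ]; ring
      simp_rw [h1]
      rw [integral_sub hi1 hi2, dualKL]
      congr 1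
      · exact integral_rnDeriv_smul (f := fun x => Real.log (truncRatio k (r x))) hac
      · simp only [Real.exp_log (truncRatio_pos k _)]
    have hi : Integrable (φ k) P := (hi1.sub hi2).congr (ae_of_all _ fun x => by
      simp only [hφ, Pi.sub_apply]; ring)
    rw [← ofReal_integral_eq_lintegral_ofReal hi
      (ae_of_all _ fun x => mul_log_truncRatio_nonneg k (r x)), heq]
    exact ENNReal.ofReal_le_ofReal (hM _ hlm ⟨_, hlb⟩)
  rw [klDiv_eq_lintegral_klFun_of_ac hac]
  -- Fatou's lemma removes the truncation.
  calc ∫⁻ x, ENNReal.ofReal (klFun (r x)) ∂P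
      = ∫⁻ x, liminf (fun k => ENNReal.ofReal (φ k x)) atTop ∂P := by
        refine lintegral_congr fun x => ?_
        exact ((ENNReal.continuous_ofReal.tendsto _).comp
          (tendsto_mul_log_truncRatio (hr0 x))).liminf_eq.symm
    _ ≤ liminf (fun k => ∫⁻ x, ENNReal.ofReal (φ k x) ∂P) atTop :=
        lintegral_liminf_le fun k => (hφm k).ennreal_ofReal
    _ ≤ ENNReal.ofReal M :=
        (liminf_le_liminf (Eventually.of_forall hφint)).trans_eq (liminf_const _)

/-- The dual variational bound: every real below the divergence is below `dualKL` at some bounded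
continuous function. -/
lemma exists_boundedContinuous_lt_dualKL {X : Type*} [TopologicalSpace X] [PolishSpace X]
    [MeasurableSpace X] [BorelSpace X] (P S : Measure X) [IsProbabilityMeasure P]
    [IsProbabilityMeasure S] {b : ℝ} (hb : ENNReal.ofReal b < klDiv S P ∨ b < 0) :
    ∃ f : X →ᵇ ℝ, b < dualKL P S f := by
  rcases hb with hb | hb
  · by_contra! h
    refine hb.not_ge (klDiv_le_of_forall_dualKL_le P S fun f hf ⟨K, hK⟩ => ?_)
    by_contra! hlt
    obtain ⟨g, hg⟩ := exists_boundedContinuous_dualKL_ge P S hf hK hlt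
    exact (h g).not_gt hg
  · exact ⟨0, by simpa [dualKL] using hb⟩

/-! ### Chernoff bound and exponential tightness -/

lemma integral_empiricalMeasure {X : Type*} [MeasurableSpace X] [MeasurableSingletonClass X]
    (n : ℕ+) (z : ℕ → X) (f : X → ℝ) :
    ∫ a, f a ∂(empiricalMeasure n z : Measure X)
      = (∑ i ∈ Finset.range n, f (z i)) / ((n : ℕ) : ℝ) := by
  change ∫ a, f a ∂(((n : ℕ) : ℝ≥0∞)⁻¹ • ∑ i ∈ Finset.range n, Measure.dirac (z i)) = _
  rw [integral_smul_measure, integral_finsetSum_measure fun i _ => integrable_dirac (by simp)]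
  simp [integral_dirac, div_eq_inv_mul]

section Chernoff

variable {Ω X : Type*} [MeasurableSpace Ω] [MeasurableSpace X] {μ : Measure Ω}
  [IsProbabilityMeasure μ] {P : ProbabilityMeasure X} {x : ℕ → Ω → X}

/-- Chernoff's bound for empirical averages, in terms of `∫ (exp f - 1) dP`. -/
lemma measure_le_integral_empiricalMeasure_le [MeasurableSingletonClass X]
    (hx : ∀ i, HasLaw (x i) (P : Measure X) μ) (hind : iIndepFun x μ) {f : X → ℝ}
    (hf : Measurable f) {C : ℝ} (hC : ∀ a, |f a| ≤ C) (n : ℕ+) (b : ℝ) :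
    μ {ω | b ≤ ∫ a, f a ∂(empiricalMeasure n (fun i => x i ω) : Measure X)}
      ≤ ENNReal.ofReal (Real.exp (-((n : ℕ) : ℝ) *
          (b - ∫ a, (Real.exp (f a) - 1) ∂(P : Measure X)))) := by
  set Λ := ∫ a, (Real.exp (f a) - 1) ∂(P : Measure X) with hΛ
  have hn : (0 : ℝ) < ((n : ℕ) : ℝ) := Nat.cast_pos.2 n.pos
  have hm : ∀ i, AEMeasurable (f ∘ x i) μ := fun i => hf.comp_aemeasurable (hx i).aemeasurable
  have hset : {ω | b ≤ ∫ a, f a ∂(empiricalMeasure n (fun i => x i ω) : Measure X)}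
      = {ω | ((n : ℕ) : ℝ) * b ≤ (∑ i ∈ Finset.range n, f ∘ x i) ω} := by
    ext ω
    simp only [Set.mem_ofPred_eq, integral_empiricalMeasure, Finset.sum_apply, Function.comp]
    rw [le_div_iff₀ hn, mul_comm]
  have hind' : iIndepFun (fun i => f ∘ x i) μ := hind.comp (fun _ => f) fun _ => hf
  have hmgf : ∀ i, mgf (f ∘ x i) μ 1 ≤ Real.exp Λ := by
    intro i
    have h1 : mgf (f ∘ x i) μ 1 = ∫ a, Real.exp (f a) ∂(P : Measure X) := by
      rw [mgf, ← (hx i).integral_comp hf.exp.aestronglyMeasurable]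
      simp [Function.comp]
    have h2 : Λ = ∫ a, Real.exp (f a) ∂(P : Measure X) - 1 := by
      have hi : Integrable (fun a => Real.exp (f a)) (P : Measure X) := by
        refine ((integrable_exp_sub_one_of_bounded hf hC).add
          (integrable_const (1 : ℝ))).congr (ae_of_all _ fun a => ?_)
        simp
      rw [hΛ, integral_sub hi (integrable_const 1)]
      simp
    -- The moment generating function is `1 + Λ ≤ exp Λ`.
    rw [h1]
    linarith [Real.add_one_le_exp Λ]
  have hexp : Integrable
      (fun ω => Real.exp (1 * (∑ i ∈ Finset.range n, f ∘ x i) ω)) μ := by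
    refine Integrable.of_bound (C := Real.exp (((n : ℕ) : ℝ) * C)) ?_ (ae_of_all _ fun ω => ?_)
    · exact (Real.measurable_exp.comp_aemeasurable
        ((Finset.aemeasurable_sum _ fun i _ => hm i).const_mul 1)).aestronglyMeasurable
    · rw [Real.norm_eq_abs, Real.abs_exp, Real.exp_le_exp, one_mul, Finset.sum_apply]
      calc ∑ i ∈ Finset.range n, (f ∘ x i) ω ≤ ∑ i ∈ Finset.range n, C :=
            Finset.sum_le_sum fun i _ => (le_abs_self _).trans (hC _)
        _ = ((n : ℕ) : ℝ) * C := by simp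
  rw [hset, ← ofReal_measureReal]
  refine ENNReal.ofReal_le_ofReal ?_
  refine (measure_ge_le_exp_mul_mgf _ zero_le_one hexp).trans ?_
  rw [hind'.mgf_sum₀ hm]
  calc Real.exp (-1 * (((n : ℕ) : ℝ) * b)) * ∏ i ∈ Finset.range n, mgf (f ∘ x i) μ 1
      ≤ Real.exp (-1 * (((n : ℕ) : ℝ) * b)) * ∏ i ∈ Finset.range n, Real.exp Λ := by
        gcongr with i _
        · exact fun _ _ => mgf_nonneg
        · exact hmgf i
    _ = Real.exp (-((n : ℕ) : ℝ) * (b - Λ)) := by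
        rw [Finset.prod_const, Finset.card_range, ← Real.exp_nat_mul, ← Real.exp_add]
        congr 1; ring

/-- Empirical measures of an i.i.d. sequence in a Polish space are exponentially tight. -/
lemma exists_isCompact_measure_empiricalMeasure_notMem_le [TopologicalSpace X] [PolishSpace X]
    [BorelSpace X] (P : ProbabilityMeasure X) (L : ℝ) :
    ∃ K : Set (ProbabilityMeasure X), IsCompact K ∧ ∃ C : ℝ, 0 ≤ C ∧
      ∀ {Ω : Type*} [MeasurableSpace Ω] {μ : Measure Ω} [IsProbabilityMeasure μ]
        {x : ℕ → Ω → X}, (∀ i, HasLaw (x i) (P : Measure X) μ) → iIndepFun x μ → ∀ n : ℕ+,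
        μ {ω | empiricalMeasure n (fun i => x i ω) ∉ K}
          ≤ ENNReal.ofReal (C * Real.exp (-((n : ℕ) : ℝ) * L)) := by
  let := TopologicalSpace.upgradeIsCompletelyMetrizable X
  have htight := isTightMeasureSet_iff_exists_isCompact_measure_compl_le.1
    (isTightMeasureSet_singleton (μ := (P : Measure X)))
  -- The test function is `t j` off `K j`. Mass above `1 / (j + 1)` there makes its integral at
  -- least `|L| + j + 1`, while `P (K j)ᶜ ≤ exp (-t j)` keeps the Chernoff correction at most `1`.
  -- The remaining exponent `n (L + j) ≥ n L + j` can be summed over `j`.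
  set t : ℕ → ℝ := fun j => (|L| + j + 1) * (j + 1) with ht
  have ht0 : ∀ j, 0 ≤ t j := fun j => by positivity
  have hK : ∀ j : ℕ, ∃ K : Set X, IsCompact K ∧
      (P : Measure X) Kᶜ ≤ ENNReal.ofReal (Real.exp (-t j)) := fun j => by
    obtain ⟨K, hK, h⟩ := htight (ENNReal.ofReal (Real.exp (-t j)))
      (ENNReal.ofReal_pos.2 (Real.exp_pos _))
    exact ⟨K, hK, h _ rfl⟩
  choose K hKc hKP using hK
  set u : ℕ → NNReal := fun j => 1 / ((j : NNReal) + 1) with hu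
  have hu0 : Tendsto u atTop (𝓝 0) := tendsto_one_div_add_atTop_nhds_zero_nat
  have hsum : Summable fun j : ℕ => Real.exp (-(j : ℝ)) := Real.summable_exp_neg_nat
  refine ⟨{ν | ∀ j, ν (K j)ᶜ ≤ u j},
    isCompact_setOfPred_probabilityMeasure_mass_eq_compl_isCompact_le hu0 hKc (Or.inl inferInstance),
    ∑' j : ℕ, Real.exp (-(j : ℝ)), tsum_nonneg fun _ => (Real.exp_pos _).le, ?_⟩
  intro Ω _ μ _ x hx hind n
  have hn1 : (1 : ℝ) ≤ ((n : ℕ) : ℝ) := Nat.one_le_cast.2 n.pos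
  have hmeas : ∀ j, MeasurableSet (K j)ᶜ := fun j => (hKc j).isClosed.measurableSet.compl
  set f : ℕ → X → ℝ := fun j => (K j)ᶜ.indicator fun _ => t j with hf
  have hfb : ∀ j a, |f j a| ≤ t j := fun j a => by
    by_cases ha : a ∈ (K j)ᶜ
    · rw [hf]; simp only [Set.indicator_of_mem ha]; exact (abs_of_nonneg (ht0 j)).le
    · rw [hf]; simp only [Set.indicator_of_notMem ha, abs_zero]; exact ht0 j
  have hΛ : ∀ j, ∫ a, (Real.exp (f j a) - 1) ∂(P : Measure X) ≤ 1 := by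
    intro j
    have h1 : ∀ a, Real.exp (f j a) - 1 = (K j)ᶜ.indicator (fun _ => Real.exp (t j) - 1) a := by
      intro a
      by_cases ha : a ∈ (K j)ᶜ
      · rw [hf]; simp only [Set.indicator_of_mem ha]
      · rw [hf]; simp only [Set.indicator_of_notMem ha, Real.exp_zero, sub_self]
    simp_rw [h1]
    rw [integral_indicator_const _ (hmeas j), smul_eq_mul]
    have h2 : (P : Measure X).real (K j)ᶜ ≤ Real.exp (-t j) :=
      ENNReal.toReal_le_of_le_ofReal (Real.exp_pos _).le (hKP j)
    have h3 : 0 ≤ (P : Measure X).real (K j)ᶜ := measureReal_nonneg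
    calc (P : Measure X).real (K j)ᶜ * (Real.exp (t j) - 1)
        ≤ (P : Measure X).real (K j)ᶜ * Real.exp (t j) := by gcongr; linarith
      _ ≤ Real.exp (-t j) * Real.exp (t j) := by gcongr
      _ = 1 := by rw [← Real.exp_add]; simp
  have hsub : {ω | empiricalMeasure n (fun i => x i ω) ∉ {ν | ∀ j, ν (K j)ᶜ ≤ u j}} ⊆
      ⋃ j, {ω | |L| + j + 1 ≤
        ∫ a, f j a ∂(empiricalMeasure n (fun i => x i ω) : Measure X)} := by
    intro ω hω
    simp only [Set.mem_ofPred_eq, not_forall, not_le] at hω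
    obtain ⟨j, hj⟩ := hω
    refine Set.mem_iUnion.2 ⟨j, ?_⟩
    rw [Set.mem_ofPred_eq, hf, integral_indicator_const _ (hmeas j), smul_eq_mul]
    have hj' : 1 / ((j : ℝ) + 1) ≤
        (empiricalMeasure n (fun i => x i ω) : Measure X).real (K j)ᶜ := by
      have := NNReal.coe_le_coe.2 hj.le
      simpa [hu] using this
    rw [div_le_iff₀ (by positivity)] at hj'
    have h4 : 0 ≤ |L| + j + 1 := by positivity
    simp only [ht]
    nlinarith
  have hbound : ∀ j : ℕ, μ {ω | |L| + j + 1 ≤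
        ∫ a, f j a ∂(empiricalMeasure n (fun i => x i ω) : Measure X)}
      ≤ ENNReal.ofReal (Real.exp (-(j : ℝ)) * Real.exp (-((n : ℕ) : ℝ) * L)) := by
    intro j
    refine (measure_le_integral_empiricalMeasure_le hx hind
      (measurable_const.indicator (hmeas j)) (hfb j) n _).trans (ENNReal.ofReal_le_ofReal ?_)
    rw [← Real.exp_add, Real.exp_le_exp]
    have h5 := hΛ j
    have h6 : L + j ≤ |L| + j + 1 - ∫ a, (Real.exp (f j a) - 1) ∂(P : Measure X) := by
      linarith [le_abs_self L]
    have h7 : (j : ℝ) ≤ ((n : ℕ) : ℝ) * j := le_mul_of_one_le_left (Nat.cast_nonneg _) hn1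
    have h8 := mul_le_mul_of_nonneg_left h6 (zero_le_one.trans hn1)
    change -((n : ℕ) : ℝ) * (|L| + j + 1 - ∫ a, (Real.exp (f j a) - 1) ∂(P : Measure X)) ≤ _
    linarith
  calc _ ≤ ∑' j, μ {ω | |L| + j + 1 ≤
          ∫ a, f j a ∂(empiricalMeasure n (fun i => x i ω) : Measure X)} :=
        (measure_mono hsub).trans (measure_iUnion_le _)
    _ ≤ ∑' j : ℕ, ENNReal.ofReal (Real.exp (-(j : ℝ)) * Real.exp (-((n : ℕ) : ℝ) * L)) :=
        ENNReal.tsum_le_tsum hbound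
    _ = _ := by
        rw [← tsum_mul_right, ENNReal.ofReal_tsum_of_nonneg (fun _ => by positivity)
          (hsum.mul_right _)]

end Chernoff

/-! ### Single-sample lower bound by change of measure -/

/-- The indicator of a box is absorbed into the factors of the density, so that the integral
factorizes by independence of the coordinates. -/
lemma pi_withDensity_prod {ι X : Type*} [Fintype ι] [MeasurableSpace X] (P : Measure X)
    [IsProbabilityMeasure P] {r : X → ℝ≥0∞} (hr : Measurable r)
    [IsProbabilityMeasure (P.withDensity r)] :
    Measure.pi (fun _ : ι => P.withDensity r)
      = (Measure.pi fun _ : ι => P).withDensity fun w => ∏ i, r (w i) := by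
  refine Measure.pi_eq fun s hs => ?_
  rw [withDensity_apply _ (MeasurableSet.univ_pi hs),
    ← lintegral_indicator (MeasurableSet.univ_pi hs)]
  have h1 : ∀ w : ι → X, (Set.univ.pi s).indicator (fun w => ∏ i, r (w i)) w
      = ∏ i, (s i).indicator r (w i) := by
    intro w
    by_cases hw : w ∈ Set.univ.pi s
    · rw [Set.indicator_of_mem hw]
      exact Finset.prod_congr rfl fun i _ => (Set.indicator_of_mem (hw i trivial) _).symm
    · rw [Set.indicator_of_notMem hw]
      simp only [Set.mem_univ_pi, not_forall] at hw
      obtain ⟨i, hi⟩ := hw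
      exact (Finset.prod_eq_zero (Finset.mem_univ i) (Set.indicator_of_notMem hi _)).symm
  simp_rw [h1]
  have hm : ∀ i, Measurable ((s i).indicator r) := fun i => hr.indicator (hs i)
  have hind : iIndepFun (fun i (w : ι → X) => (s i).indicator r (w i))
      (Measure.pi fun _ : ι => P) := iIndepFun_pi fun i => (hm i).aemeasurable
  rw [lintegral_prod_eq_prod_lintegral_of_indepFun Finset.univ _ hind
    fun i => (hm i).comp (measurable_pi_apply i)]
  refine Finset.prod_congr rfl fun i _ => ?_
  rw [(measurePreserving_eval (fun _ : ι => P) i).lintegral_comp (hm i),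
    lintegral_indicator (hs i), withDensity_apply _ (hs i)]

lemma ae_tendsto_average_infinitePi {X : Type*} [MeasurableSpace X] (S : Measure X)
    [IsProbabilityMeasure S] {f : X → ℝ} (hf : Measurable f) (hfi : Integrable f S) :
    ∀ᵐ z ∂(Measure.infinitePi fun _ : ℕ => S),
      Tendsto (fun n : ℕ => (∑ i ∈ Finset.range n, f (z i)) / (n : ℝ)) atTop
        (𝓝 (∫ a, f a ∂S)) := by
  have hmp : ∀ i : ℕ, MeasurePreserving (fun z : ℕ → X => z i)
      (Measure.infinitePi fun _ : ℕ => S) S := fun i =>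
    measurePreserving_eval_infinitePi (fun _ : ℕ => S) i
  have hint : Integrable (fun z : ℕ → X => f (z 0)) (Measure.infinitePi fun _ : ℕ => S) :=
    (hmp 0).integrable_comp_of_integrable hfi
  have hind : iIndepFun (fun (i : ℕ) (z : ℕ → X) => f (z i))
      (Measure.infinitePi fun _ : ℕ => S) := iIndepFun_infinitePi fun _ => hf
  have hid : ∀ i : ℕ, IdentDistrib (fun z : ℕ → X => f (z i)) (fun z => f (z 0))
      (Measure.infinitePi fun _ : ℕ => S) (Measure.infinitePi fun _ : ℕ => S) := fun i =>
    (IdentDistrib.mk (hmp i).measurable.aemeasurable (hmp 0).measurable.aemeasurable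
      ((hmp i).map_eq.trans (hmp 0).map_eq.symm)).comp hf
  have h := strong_law_ae_real (fun (i : ℕ) (z : ℕ → X) => f (z i)) hint
    (fun i j hij => hind.indepFun hij) hid
  have h0 : ∫ z : ℕ → X, f (z 0) ∂(Measure.infinitePi fun _ : ℕ => S) = ∫ a, f a ∂S := by
    have := integral_map (μ := Measure.infinitePi fun _ : ℕ => S)
      (hmp 0).measurable.aemeasurable (f := f) hf.aestronglyMeasurable
    rw [(hmp 0).map_eq] at this
    exact this.symm
  rwa [h0] at h

/-- Weak neighbourhoods are determined by finitely many integrals of bounded continuous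
functions. -/
lemma exists_finite_integral_mem_of_mem_nhds {X : Type*} [TopologicalSpace X] [MeasurableSpace X]
    [OpensMeasurableSpace X] {R : ProbabilityMeasure X} {U : Set (ProbabilityMeasure X)}
    (hU : U ∈ 𝓝 R) : ∃ F : Set (X →ᵇ ℝ), F.Finite ∧ ∃ O : (X →ᵇ ℝ) → Set ℝ,
      (∀ f, IsOpen (O f)) ∧ (∀ f, ∫ a, f a ∂(R : Measure X) ∈ O f) ∧
      ∀ ν : ProbabilityMeasure X, (∀ f ∈ F, ∫ a, f a ∂(ν : Measure X) ∈ O f) → ν ∈ U := by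
  set I : ProbabilityMeasure X → (X →ᵇ ℝ) → ℝ := fun ν f => ∫ a, f a ∂(ν : Measure X) with hI
  have hle : Tendsto id (comap I (𝓝 (I R))) (𝓝 R) :=
    ProbabilityMeasure.tendsto_iff_forall_integral_tendsto.2
      (tendsto_pi_nhds.1 (tendsto_comap (f := I)))
  obtain ⟨V, hV, hVU⟩ := mem_comap.1 (hle hU)
  rw [nhds_pi, Filter.mem_pi] at hV
  obtain ⟨F, hF, t, ht, htV⟩ := hV
  refine ⟨F, hF, fun f => interior (t f), fun f => isOpen_interior,
    fun f => mem_interior_iff_mem_nhds.2 (ht f), fun ν hν => hVU (htV fun f hf => ?_)⟩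
  exact interior_subset (hν f hf)

/-- The lower bound in Sanov's theorem for a single sample. -/
lemma exists_measurableSet_infinitePi_ge {X : Type*} [TopologicalSpace X] [PolishSpace X]
    [MeasurableSpace X] [BorelSpace X] (P R : ProbabilityMeasure X)
    (hkl : klDiv (R : Measure X) (P : Measure X) ≠ ∞) {U : Set (ProbabilityMeasure X)}
    (hU : U ∈ 𝓝 R) {d : ℝ} (hd : (klDiv (R : Measure X) (P : Measure X)).toReal < d) :
    ∃ A : ℕ → Set (ℕ → X), (∀ n, MeasurableSet (A n)) ∧
      (∀ n : ℕ+, ∀ z ∈ A n, empiricalMeasure n z ∈ U) ∧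
      ∀ᶠ n : ℕ in atTop, ENNReal.ofReal (Real.exp (-(n : ℝ) * d) / 2)
        ≤ Measure.infinitePi (fun _ : ℕ => (P : Measure X)) (A n) := by
  obtain ⟨hac, hllr⟩ := klDiv_ne_top_iff.1 hkl
  obtain ⟨F, hF, O, hO, hRO, hOU⟩ := exists_finite_integral_mem_of_mem_nhds hU
  set r : X → ℝ≥0∞ := (R : Measure X).rnDeriv (P : Measure X) with hr
  have hrm : Measurable r := Measure.measurable_rnDeriv _ _
  have hRr : (P : Measure X).withDensity r = R := Measure.withDensity_rnDeriv_eq _ _ hac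
  -- `B n` forces the empirical measure into `U`; on `G n` the density of `R^n` with respect to
  -- `P^n` is at most `exp (n d)`. Hence `P^n (B n) ≥ exp (-n d) R^n (B n ∩ G n)`.
  set B : (n : ℕ) → Set (Finset.range n → X) := fun n =>
    ⋂ f ∈ F, {w | (∑ i, f (w i)) / (n : ℝ) ∈ O f} with hB
  set G : (n : ℕ) → Set (Finset.range n → X) := fun n =>
    {w | ∏ i, r (w i) ≤ ENNReal.ofReal (Real.exp ((n : ℝ) * d))} with hG
  have hBm : ∀ n, MeasurableSet (B n) := fun n => by
    refine MeasurableSet.biInter hF.countable fun f _ => ?_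
    have hfm : Measurable f := f.continuous.measurable
    exact ((Finset.measurable_sum _ fun i _ => hfm.comp (measurable_pi_apply i)).div_const _)
      (hO f).measurableSet
  have hGm : ∀ n, MeasurableSet (G n) := fun n =>
    measurableSet_le (Finset.measurable_prod _ fun i _ => hrm.comp (measurable_pi_apply i))
      measurable_const
  have hres : ∀ n, Measurable (Finset.restrict (π := fun _ : ℕ => X) (Finset.range n)) :=
    fun n => Finset.measurable_restrict _
  have hmap : ∀ (S : ProbabilityMeasure X) (n : ℕ) {C : Set (Finset.range n → X)},
      MeasurableSet C → Measure.infinitePi (fun _ : ℕ => (S : Measure X))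
        (Finset.restrict (π := fun _ : ℕ => X) (Finset.range n) ⁻¹' C)
        = Measure.pi (fun _ : Finset.range n => (S : Measure X)) C := fun S n C hC => by
    rw [← Measure.infinitePi_map_restrict (fun _ : ℕ => (S : Measure X)),
      Measure.map_apply (hres n) hC]
  refine ⟨fun n => Finset.restrict (π := fun _ : ℕ => X) (Finset.range n) ⁻¹' B n,
    fun n => hres n (hBm n), fun n z hz => hOU _ fun f hf => ?_, ?_⟩
  · have := Set.mem_iInter₂.1 hz f hf
    simp only [Set.mem_ofPred_eq, Finset.restrict] at this
    rw [integral_empiricalMeasure, ← Finset.sum_coe_sort (Finset.range n) fun i => f (z i)]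
    exact this
  -- Under `R`, almost every sequence is eventually in both events: apply the strong law to each `f
  -- ∈ F` and to the log-likelihood ratio, whose mean is below `d`.
  have hlim : Tendsto (fun n => Measure.infinitePi (fun _ : ℕ => (R : Measure X))
      (Finset.restrict (π := fun _ : ℕ => X) (Finset.range n) ⁻¹' (B n ∩ G n))) atTop
      (𝓝 (Measure.infinitePi (fun _ : ℕ => (R : Measure X)) Set.univ)) := by
    refine tendsto_measure_of_ae_tendsto_indicator_of_isFiniteMeasure atTop MeasurableSet.univ
      (fun n => hres n ((hBm n).inter (hGm n))) ?_
    have h1 : ∀ᵐ z ∂(Measure.infinitePi fun _ : ℕ => (R : Measure X)), ∀ f ∈ F,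
        ∀ᶠ n : ℕ in atTop, (∑ i ∈ Finset.range n, f (z i)) / (n : ℝ) ∈ O f := by
      refine (ae_ball_iff hF.countable).2 fun f _ => ?_
      filter_upwards [ae_tendsto_average_infinitePi (R : Measure X) f.continuous.measurable
        (f.integrable _)] with z hz
      exact hz.eventually ((hO f).mem_nhds (hRO f))
    -- Positivity and finiteness of `r` are needed for `exp (llr) = r`, since `log 0 = 0` by
    -- convention.
    have hrpos : ∀ᵐ a ∂(R : Measure X), 0 < (r a).toReal := by
      filter_upwards [Measure.rnDeriv_pos hac, hac.ae_le
        (Measure.rnDeriv_lt_top (R : Measure X) (P : Measure X))]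
        with a ha1 ha2
      exact ENNReal.toReal_pos ha1.ne' ha2.ne
    have h2 : ∀ᵐ z ∂(Measure.infinitePi fun _ : ℕ => (R : Measure X)), ∀ i, 0 < (r (z i)).toReal :=
      ae_all_iff.2 fun i =>
        (measurePreserving_eval_infinitePi (fun _ : ℕ => (R : Measure X)) i).quasiMeasurePreserving.ae
          hrpos
    filter_upwards [h1, h2, ae_tendsto_average_infinitePi (R : Measure X)
      (measurable_llr (R : Measure X) (P : Measure X)) hllr] with z hz1 hz2 hz3
    rw [← toReal_klDiv_of_measure_eq hac (by simp)] at hz3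
    filter_upwards [(eventually_all_finite hF).2 hz1, hz3.eventually_lt_const hd,
      eventually_gt_atTop 0] with n hn1 hn2 hn3
    refine iff_of_true ⟨Set.mem_iInter₂.2 fun f hf => ?_, ?_⟩ trivial
    · have := hn1 f hf
      rw [← Finset.sum_coe_sort (Finset.range n) fun i => f (z i)] at this
      exact this
    · change ∏ i : Finset.range n, r (z i) ≤ _
      rw [Finset.prod_coe_sort (Finset.range n) fun i => r (z i)]
      have h3 : ∀ i, r (z i)
          = ENNReal.ofReal (Real.exp (llr (R : Measure X) (P : Measure X) (z i))) := fun i => by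
        rw [llr, Real.exp_log (hz2 i), ENNReal.ofReal_toReal]
        intro htop
        have := hz2 i
        rw [htop] at this
        simp at this
      rw [Finset.prod_congr rfl fun i _ => h3 i,
        ← ENNReal.ofReal_prod_of_nonneg fun _ _ => (Real.exp_pos _).le, ← Real.exp_sum]
      refine ENNReal.ofReal_le_ofReal (Real.exp_le_exp.2 ?_)
      rw [div_lt_iff₀ (Nat.cast_pos.2 hn3)] at hn2
      linarith
  rw [measure_univ] at hlim
  filter_upwards [hlim.eventually_const_le (u := ENNReal.ofReal (1 / 2)) (by
    rw [← ENNReal.ofReal_one]; exact (ENNReal.ofReal_lt_ofReal_iff one_pos).2 (by norm_num))]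
    with n hn
  rw [hmap R n ((hBm n).inter (hGm n))] at hn
  rw [hmap P n (hBm n)]
  have : IsProbabilityMeasure ((P : Measure X).withDensity r) := by rw [hRr]; infer_instance
  have hchange : Measure.pi (fun _ : Finset.range n => (R : Measure X)) (B n ∩ G n)
      ≤ ENNReal.ofReal (Real.exp ((n : ℝ) * d))
        * Measure.pi (fun _ : Finset.range n => (P : Measure X)) (B n) := by
    rw [← hRr, pi_withDensity_prod (P : Measure X) hrm,
      withDensity_apply _ ((hBm n).inter (hGm n))]
    calc _ ≤ ∫⁻ _ in B n ∩ G n, ENNReal.ofReal (Real.exp ((n : ℝ) * d))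
            ∂(Measure.pi fun _ : Finset.range n => (P : Measure X)) :=
          setLIntegral_mono measurable_const fun w hw => hw.2
      _ ≤ _ := by
          rw [setLIntegral_const]
          gcongr
          exact Set.inter_subset_left
  calc ENNReal.ofReal (Real.exp (-(n : ℝ) * d) / 2)
      = ENNReal.ofReal (Real.exp (-(n : ℝ) * d)) * ENNReal.ofReal (1 / 2) := by
        rw [← ENNReal.ofReal_mul (Real.exp_pos _).le]; congr 1; ring
    _ ≤ ENNReal.ofReal (Real.exp (-(n : ℝ) * d)) * (ENNReal.ofReal (Real.exp ((n : ℝ) * d))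
        * Measure.pi (fun _ : Finset.range n => (P : Measure X)) (B n)) := by
        gcongr
        exact hn.trans hchange
    _ = Measure.pi (fun _ : Finset.range n => (P : Measure X)) (B n) := by
        rw [← mul_assoc, ← ENNReal.ofReal_mul (Real.exp_pos _).le, ← Real.exp_add]
        simp

lemma measurable_integral_empiricalMeasure {X : Type*} [MeasurableSpace X]
    [MeasurableSingletonClass X] (n : ℕ+) {f : X → ℝ} (hf : Measurable f) :
    Measurable fun z : ℕ → X => ∫ a, f a ∂(empiricalMeasure n z : Measure X) := by
  simp_rw [integral_empiricalMeasure]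
  exact (Finset.measurable_sum _ fun i _ => hf.comp (measurable_pi_apply i)).div_const _

/-! ### The pair rate, asymptotics of the sample sizes, and the exponent -/

section PairRate

variable {X : Type*} [MeasurableSpace X] {P Q : ProbabilityMeasure X} {c : ℝ}
  {p : ProbabilityMeasure X × ProbabilityMeasure X}

lemma klDiv_ne_top_of_pairRate_ne_top (hc0 : 0 < c) (hc1 : c < 1) (h : pairRate c P Q p ≠ ∞) :
    klDiv (p.1 : Measure X) (P : Measure X) ≠ ∞ ∧
      klDiv (p.2 : Measure X) (Q : Measure X) ≠ ∞ := by
  rw [pairRate, ENNReal.add_ne_top] at h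
  refine ⟨fun htop => h.1 ?_, fun htop => h.2 ?_⟩
  · rw [htop, ENNReal.mul_top (ENNReal.ofReal_pos.2 hc0).ne']
  · rw [htop, ENNReal.mul_top (ENNReal.ofReal_pos.2 (sub_pos.2 hc1)).ne']

lemma toReal_pairRate (hc0 : 0 < c) (hc1 : c < 1) (h : pairRate c P Q p ≠ ∞) :
    (pairRate c P Q p).toReal = c * (klDiv (p.1 : Measure X) (P : Measure X)).toReal
      + (1 - c) * (klDiv (p.2 : Measure X) (Q : Measure X)).toReal := by
  have h' := h
  rw [pairRate, ENNReal.add_ne_top] at h'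
  rw [pairRate, ENNReal.toReal_add h'.1 h'.2, ENNReal.toReal_mul, ENNReal.toReal_mul,
    ENNReal.toReal_ofReal hc0.le, ENNReal.toReal_ofReal (sub_pos.2 hc1).le]

lemma coe_pairRate_eq_toReal (h : pairRate c P Q p ≠ ∞) :
    ((pairRate c P Q p : ℝ≥0∞) : EReal) = ((pairRate c P Q p).toReal : EReal) :=
  (EReal.coe_ennreal_toReal h).symm

/-- If one divergence is infinite, its test function alone suffices, the other being `0`. If both
are finite, a loss of `ρ - a` in each is affordable because the weights `c` and `1 - c` sum to `1`.
-/
lemma exists_lt_dualKL_of_lt_pairRate [TopologicalSpace X] [PolishSpace X] [BorelSpace X]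
    (hc0 : 0 < c) (hc1 : c < 1) {a : ℝ} (ha : (a : EReal) < (pairRate c P Q p : ℝ≥0∞)) :
    ∃ f g : X →ᵇ ℝ, a < c * dualKL (P : Measure X) (p.1 : Measure X) f
      + (1 - c) * dualKL (Q : Measure X) (p.2 : Measure X) g := by
  have hc1' := sub_pos.2 hc1
  have h0 : ∀ R S : ProbabilityMeasure X,
      dualKL (R : Measure X) (S : Measure X) ((0 : X →ᵇ ℝ) : X → ℝ) = 0 := fun R S => by
    simp [dualKL]
  by_cases h1 : klDiv (p.1 : Measure X) (P : Measure X) = ∞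
  · obtain ⟨f, hf⟩ := exists_boundedContinuous_lt_dualKL (P : Measure X) (p.1 : Measure X)
      (b := a / c) (Or.inl (h1 ▸ ENNReal.ofReal_lt_top))
    refine ⟨f, 0, ?_⟩
    rw [h0, mul_zero, add_zero]
    rw [div_lt_iff₀ hc0] at hf
    linarith
  by_cases h2 : klDiv (p.2 : Measure X) (Q : Measure X) = ∞
  · obtain ⟨g, hg⟩ := exists_boundedContinuous_lt_dualKL (Q : Measure X) (p.2 : Measure X)
      (b := a / (1 - c)) (Or.inl (h2 ▸ ENNReal.ofReal_lt_top))
    refine ⟨0, g, ?_⟩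
    rw [h0, mul_zero, zero_add]
    rw [div_lt_iff₀ hc1'] at hg
    linarith
  have hne : pairRate c P Q p ≠ ∞ := by
    rw [pairRate, ENNReal.add_ne_top]
    exact ⟨ENNReal.mul_ne_top ENNReal.ofReal_ne_top h1, ENNReal.mul_ne_top ENNReal.ofReal_ne_top h2⟩
  rw [coe_pairRate_eq_toReal hne, EReal.coe_lt_coe_iff, toReal_pairRate hc0 hc1 hne] at ha
  have key : ∀ R S : ProbabilityMeasure X, klDiv (S : Measure X) (R : Measure X) ≠ ∞ →
      ∀ ε > 0, ∃ f : X →ᵇ ℝ, (klDiv (S : Measure X) (R : Measure X)).toReal - ε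
        < dualKL (R : Measure X) (S : Measure X) f := by
    intro R S hRS ε hε
    refine exists_boundedContinuous_lt_dualKL _ _ ?_
    rcases lt_or_ge ((klDiv (S : Measure X) (R : Measure X)).toReal - ε) 0 with h | h
    · exact Or.inr h
    · left
      rw [← ENNReal.ofReal_toReal hRS, ENNReal.toReal_ofReal ENNReal.toReal_nonneg]
      exact (ENNReal.ofReal_lt_ofReal_iff (by linarith)).2 (by linarith)
  set ρ := c * (klDiv (p.1 : Measure X) (P : Measure X)).toReal
      + (1 - c) * (klDiv (p.2 : Measure X) (Q : Measure X)).toReal with hρ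
  obtain ⟨f, hf⟩ := key P p.1 h1 (ρ - a) (by linarith)
  obtain ⟨g, hg⟩ := key Q p.2 h2 (ρ - a) (by linarith)
  have hf' := mul_lt_mul_of_pos_left hf hc0
  have hg' := mul_lt_mul_of_pos_left hg hc1'
  exact ⟨f, g, by linarith⟩

end PairRate

section Asymptotics

variable {ι : Type*} {l : Filter ι} {n m : ι → ℕ+} {c : ℝ}

lemma tendsto_natCast_add_atTop (hn : Tendsto (fun k => (n k : ℕ)) l atTop) :
    Tendsto (fun k => ((n k : ℕ) : ℝ) + ((m k : ℕ) : ℝ)) l atTop :=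
  tendsto_atTop_mono (fun _ => le_add_of_nonneg_right (Nat.cast_nonneg _))
    (tendsto_natCast_atTop_atTop.comp hn)

/-- If `n / (n + m) → c` then `n d₁ + m d₂ + C ≤ (n + m) b` eventually, whenever
`c d₁ + (1 - c) d₂ < b`. -/
lemma eventually_mul_add_mul_add_le (hn : Tendsto (fun k => (n k : ℕ)) l atTop)
    (hc : Tendsto (fun k => ((n k : ℕ) : ℝ) / (((n k : ℕ) : ℝ) + ((m k : ℕ) : ℝ))) l (𝓝 c))
    {d₁ d₂ b : ℝ} (C : ℝ) (hb : c * d₁ + (1 - c) * d₂ < b) :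
    ∀ᶠ k in l, ((n k : ℕ) : ℝ) * d₁ + ((m k : ℕ) : ℝ) * d₂ + C
      ≤ (((n k : ℕ) : ℝ) + ((m k : ℕ) : ℝ)) * b := by
  have hC : Tendsto (fun k => C / (((n k : ℕ) : ℝ) + ((m k : ℕ) : ℝ))) l (𝓝 0) :=
    (tendsto_natCast_add_atTop hn).const_div_atTop C
  have hlim := ((hc.mul_const d₁).add ((hc.const_sub 1).mul_const d₂)).add hC
  rw [add_zero] at hlim
  filter_upwards [hlim.eventually_lt_const hb] with k hk
  have hN : (0 : ℝ) < ((n k : ℕ) : ℝ) + ((m k : ℕ) : ℝ) :=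
    add_pos (Nat.cast_pos.2 (n k).pos) (Nat.cast_pos.2 (m k).pos)
  have h := mul_le_mul_of_nonneg_left hk.le hN.le
  refine le_trans (le_of_eq ?_) h
  field_simp
  ring

end Asymptotics

section Exponent

variable {Ω X : Type*} [MeasurableSpace Ω] [MeasurableSpace X] {μ : Measure Ω}
  {x y : ℕ → Ω → X} {Γ : Set (ProbabilityMeasure X × ProbabilityMeasure X)} {n m : ℕ+}

/-- Writing a real as the exponent of an exponential reduces both bounds on `empiricalExponent` to
monotonicity of the logarithm, with no separate case for probability zero. -/
lemma neg_one_div_mul_log_ofReal_exp (n m : ℕ+) (a : ℝ) :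
    ((-(1 / (((n : ℕ) : ℝ) + ((m : ℕ) : ℝ))) : ℝ) : EReal) *
      ENNReal.log (ENNReal.ofReal (Real.exp (-(((n : ℕ) : ℝ) + ((m : ℕ) : ℝ)) * a))) = a := by
  have hN : (0 : ℝ) < ((n : ℕ) : ℝ) + ((m : ℕ) : ℝ) :=
    add_pos (Nat.cast_pos.2 n.pos) (Nat.cast_pos.2 m.pos)
  rw [ENNReal.log_ofReal, if_neg (Real.exp_pos _).not_ge, Real.log_exp, ← EReal.coe_mul]
  congr 1
  field_simp

lemma neg_one_div_add_nonpos (n m : ℕ+) :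
    ((-(1 / (((n : ℕ) : ℝ) + ((m : ℕ) : ℝ))) : ℝ) : EReal) ≤ 0 := by
  rw [← EReal.coe_zero, EReal.coe_le_coe_iff]
  exact neg_nonpos.2 (by positivity)

lemma le_empiricalExponent {a : ℝ}
    (h : μ {ω | (empiricalMeasure n (fun i => x i ω), empiricalMeasure m (fun i => y i ω)) ∈ Γ}
      ≤ ENNReal.ofReal (Real.exp (-(((n : ℕ) : ℝ) + ((m : ℕ) : ℝ)) * a))) :
    (a : EReal) ≤ empiricalExponent μ x y Γ n m := by
  conv_lhs => rw [← neg_one_div_mul_log_ofReal_exp n m a]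
  rw [empiricalExponent, mul_comm, mul_comm _ (ENNReal.log (μ _))]
  exact EReal.mul_le_mul_of_nonpos_right (ENNReal.log_le_log h) (neg_one_div_add_nonpos n m)

lemma empiricalExponent_le {a : ℝ}
    (h : ENNReal.ofReal (Real.exp (-(((n : ℕ) : ℝ) + ((m : ℕ) : ℝ)) * a)) ≤
      μ {ω | (empiricalMeasure n (fun i => x i ω), empiricalMeasure m (fun i => y i ω)) ∈ Γ}) :
    empiricalExponent μ x y Γ n m ≤ (a : EReal) := by
  conv_rhs => rw [← neg_one_div_mul_log_ofReal_exp n m a]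
  rw [empiricalExponent, mul_comm, mul_comm _ (ENNReal.log (ENNReal.ofReal _))]
  exact EReal.mul_le_mul_of_nonpos_right (ENNReal.log_le_log h) (neg_one_div_add_nonpos n m)

end Exponent

/-- Transfers the lower bound from the canonical product space to `Ω`. -/
lemma measure_preimage_sequence_eq_infinitePi {Ω X : Type*} [MeasurableSpace Ω]
    [MeasurableSpace X] {μ : Measure Ω} [IsProbabilityMeasure μ] {P : ProbabilityMeasure X}
    {x : ℕ → Ω → X} (hx : ∀ i, HasLaw (x i) (P : Measure X) μ)
    (hind : iIndepFun x μ) {A : Set (ℕ → X)} (hA : MeasurableSet A) :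
    μ ((fun ω i => x i ω) ⁻¹' A) = Measure.infinitePi (fun _ : ℕ => (P : Measure X)) A := by
  have hm : AEMeasurable (fun ω i => x i ω) μ := aemeasurable_pi_iff.2 fun i => (hx i).aemeasurable
  have h := (iIndepFun_iff_map_fun_eq_infinitePi_map₀ hm).1 hind
  simp_rw [(hx _).map_eq] at h
  rw [← h, Measure.map_apply_of_aemeasurable hm hA]

/-! ### Two-sample bounds -/

section TwoSample

variable {X : Type*} [TopologicalSpace X] [PolishSpace X] [MeasurableSpace X] [BorelSpace X]
  {P Q : ProbabilityMeasure X} {Ω : Type*} [MeasurableSpace Ω] {μ : Measure Ω}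
  [IsProbabilityMeasure μ] {x y : ℕ → Ω → X} {ι : Type*} {l : Filter ι} {n m : ι → ℕ+} {c : ℝ}

/-- A pair whose rate exceeds `a` has a neighbourhood of exponentially small probability. -/
lemma exists_nhds_measure_empiricalMeasure_mem_le
    (hx : ∀ i, HasLaw (x i) (P : Measure X) μ) (hy : ∀ i, HasLaw (y i) (Q : Measure X) μ)
    (hx_indep : iIndepFun x μ) (hy_indep : iIndepFun y μ)
    (hxy : IndepFun (fun ω i => x i ω) (fun ω i => y i ω) μ)
    (hn : Tendsto (fun k => (n k : ℕ)) l atTop) (hc0 : 0 < c) (hc1 : c < 1)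
    (hc : Tendsto (fun k => ((n k : ℕ) : ℝ) / (((n k : ℕ) : ℝ) + ((m k : ℕ) : ℝ))) l (𝓝 c))
    {p : ProbabilityMeasure X × ProbabilityMeasure X} {a : ℝ}
    (ha : (a : EReal) < (pairRate c P Q p : ℝ≥0∞)) :
    ∃ W ∈ 𝓝 p, ∀ᶠ k in l, μ {ω | (empiricalMeasure (n k) (fun i => x i ω),
        empiricalMeasure (m k) (fun i => y i ω)) ∈ W}
      ≤ ENNReal.ofReal (Real.exp (-(((n k : ℕ) : ℝ) + ((m k : ℕ) : ℝ)) * a)) := by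
  obtain ⟨f, g, hfg⟩ := exists_lt_dualKL_of_lt_pairRate hc0 hc1 ha
  set F := dualKL (P : Measure X) (p.1 : Measure X) f with hF
  set G := dualKL (Q : Measure X) (p.2 : Measure X) g with hG
  -- Lowering both thresholds by `δ` leaves `c (F - δ) + (1 - c) (G - δ) = a + δ`, still above `a`.
  set δ : ℝ := (c * F + (1 - c) * G - a) / 2 with hδ
  have hδ0 : 0 < δ := by rw [hδ]; linarith
  have hcont : ∀ h : X →ᵇ ℝ, Continuous fun ν : ProbabilityMeasure X => ∫ a, h a ∂(ν : Measure X) :=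
    fun h => continuous_iff_continuousAt.2 fun ν =>
      ProbabilityMeasure.tendsto_iff_forall_integral_tendsto.1 tendsto_id h
  set b₁ := ∫ a, f a ∂(p.1 : Measure X) - δ with hb₁
  set b₂ := ∫ a, g a ∂(p.2 : Measure X) - δ with hb₂
  refine ⟨{ν : ProbabilityMeasure X | b₁ < ∫ a, f a ∂(ν : Measure X)} ×ˢ
      {ν : ProbabilityMeasure X | b₂ < ∫ a, g a ∂(ν : Measure X)},
    prod_mem_nhds ((isOpen_lt continuous_const (hcont f)).mem_nhds (sub_lt_self _ hδ0))
      ((isOpen_lt continuous_const (hcont g)).mem_nhds (sub_lt_self _ hδ0)), ?_⟩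
  filter_upwards [eventually_mul_add_mul_add_le (m := m) hn hc (d₁ := -(F - δ)) (d₂ := -(G - δ))
    (b := -a) 0 (by linarith)] with k hk
  have hfm : Measurable f := f.continuous.measurable
  have hgm : Measurable g := g.continuous.measurable
  set A : Set (ℕ → X) := {z | b₁ ≤ ∫ a, f a ∂(empiricalMeasure (n k) z : Measure X)} with hA
  set B : Set (ℕ → X) := {z | b₂ ≤ ∫ a, g a ∂(empiricalMeasure (m k) z : Measure X)} with hB
  have hAm : MeasurableSet A :=
    measurableSet_le measurable_const (measurable_integral_empiricalMeasure (n k) hfm)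
  have hBm : MeasurableSet B :=
    measurableSet_le measurable_const (measurable_integral_empiricalMeasure (m k) hgm)
  have h1 := measure_le_integral_empiricalMeasure_le hx hx_indep hfm
    (fun a => f.norm_coe_le_norm a) (n k) b₁
  have h2 := measure_le_integral_empiricalMeasure_le hy hy_indep hgm
    (fun a => g.norm_coe_le_norm a) (m k) b₂
  calc _ ≤ μ ((fun ω i => x i ω) ⁻¹' A ∩ (fun ω i => y i ω) ⁻¹' B) :=
        measure_mono fun ω hω => by
          have hω₁ : b₁ < ∫ a, f a ∂(empiricalMeasure (n k) (fun i => x i ω) : Measure X) := hω.1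
          have hω₂ : b₂ < ∫ a, g a ∂(empiricalMeasure (m k) (fun i => y i ω) : Measure X) := hω.2
          exact ⟨hω₁.le, hω₂.le⟩
    _ = μ ((fun ω i => x i ω) ⁻¹' A) * μ ((fun ω i => y i ω) ⁻¹' B) :=
        hxy.measure_inter_preimage_eq_mul _ _ hAm hBm
    _ ≤ _ := mul_le_mul' h1 h2
    _ ≤ _ := by
        rw [← ENNReal.ofReal_mul (Real.exp_pos _).le, ← Real.exp_add]
        refine ENNReal.ofReal_le_ofReal (Real.exp_le_exp.2 ?_)
        have e1 : b₁ - ∫ a, (Real.exp (f a) - 1) ∂(P : Measure X) = F - δ := by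
          rw [hb₁, hF, dualKL]; ring
        have e2 : b₂ - ∫ a, (Real.exp (g a) - 1) ∂(Q : Measure X) = G - δ := by
          rw [hb₂, hG, dualKL]; ring
        rw [e1, e2]
        linarith

/-- The upper bound on probabilities in the two-sample Sanov theorem. -/
lemma eventually_measure_empiricalMeasure_mem_le
    (hx : ∀ i, HasLaw (x i) (P : Measure X) μ) (hy : ∀ i, HasLaw (y i) (Q : Measure X) μ)
    (hx_indep : iIndepFun x μ) (hy_indep : iIndepFun y μ)
    (hxy : IndepFun (fun ω i => x i ω) (fun ω i => y i ω) μ)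
    (hn : Tendsto (fun k => (n k : ℕ)) l atTop) (hc0 : 0 < c) (hc1 : c < 1)
    (hc : Tendsto (fun k => ((n k : ℕ) : ℝ) / (((n k : ℕ) : ℝ) + ((m k : ℕ) : ℝ))) l (𝓝 c))
    {Γ : Set (ProbabilityMeasure X × ProbabilityMeasure X)} {a : ℝ}
    (ha : ∀ p ∈ closure Γ, (a : EReal) < (pairRate c P Q p : ℝ≥0∞)) :
    ∃ C : ℝ, 0 ≤ C ∧ ∀ᶠ k in l, μ {ω | (empiricalMeasure (n k) (fun i => x i ω),
        empiricalMeasure (m k) (fun i => y i ω)) ∈ Γ}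
      ≤ ENNReal.ofReal (C * Real.exp (-(((n k : ℕ) : ℝ) + ((m k : ℕ) : ℝ)) * a)) := by
  have hc1' := sub_pos.2 hc1
  -- Since `n` is about `c (n + m)`, level `(|a| + 1) / c` gives decay of rate about `|a| + 1` in `n
  -- + m`; the extra `1` absorbs the error in `n / (n + m) → c`.
  obtain ⟨K₁, hK₁, C₁, hC₁, h₁⟩ :=
    exists_isCompact_measure_empiricalMeasure_notMem_le P ((|a| + 1) / c)
  obtain ⟨K₂, hK₂, C₂, hC₂, h₂⟩ :=
    exists_isCompact_measure_empiricalMeasure_notMem_le Q ((|a| + 1) / (1 - c))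
  have hcompact : IsCompact (K₁ ×ˢ K₂ ∩ closure Γ) := (hK₁.prod hK₂).inter_right isClosed_closure
  obtain ⟨C₀, hC₀, h₀⟩ : ∃ C : ℝ, 0 ≤ C ∧ ∀ᶠ k in l, μ {ω | (empiricalMeasure (n k) (fun i => x i ω),
        empiricalMeasure (m k) (fun i => y i ω)) ∈ K₁ ×ˢ K₂ ∩ closure Γ}
      ≤ ENNReal.ofReal (C * Real.exp (-(((n k : ℕ) : ℝ) + ((m k : ℕ) : ℝ)) * a)) := by
    -- The property passes to subsets and finite unions, the constants `C` adding up, so the local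
    -- bounds suffice.
    refine hcompact.induction_on (p := fun W => ∃ C : ℝ, 0 ≤ C ∧ ∀ᶠ k in l,
      μ {ω | (empiricalMeasure (n k) (fun i => x i ω),
        empiricalMeasure (m k) (fun i => y i ω)) ∈ W}
      ≤ ENNReal.ofReal (C * Real.exp (-(((n k : ℕ) : ℝ) + ((m k : ℕ) : ℝ)) * a)))
      ⟨0, le_rfl, Eventually.of_forall fun k => by simp⟩ ?_ ?_ ?_
    · rintro s t hst ⟨C, hC, h⟩
      exact ⟨C, hC, h.mono fun k hk => le_trans (measure_mono fun ω hω => hst hω) hk⟩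
    · rintro s t ⟨C, hC, h⟩ ⟨C', hC', h'⟩
      refine ⟨C + C', add_nonneg hC hC', ?_⟩
      filter_upwards [h, h'] with k hk hk'
      rw [add_mul, ENNReal.ofReal_add (by positivity) (by positivity)]
      exact (measure_union_le _ _).trans (add_le_add hk hk')
    · intro p hp
      obtain ⟨W, hW, h⟩ := exists_nhds_measure_empiricalMeasure_mem_le hx hy hx_indep hy_indep hxy
        hn hc0 hc1 hc (ha p hp.2)
      exact ⟨W, mem_nhdsWithin_of_mem_nhds hW, 1, zero_le_one, by simpa using h⟩
  refine ⟨C₀ + C₁ + C₂, by positivity, ?_⟩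
  have hdiv₁ : c * ((|a| + 1) / c) = |a| + 1 := by field_simp
  have hdiv₂ : (1 - c) * ((|a| + 1) / (1 - c)) = |a| + 1 := by field_simp
  filter_upwards [h₀,
    eventually_mul_add_mul_add_le (m := m) hn hc (d₁ := -((|a| + 1) / c)) (d₂ := 0) (b := -a) 0
      (by linarith [le_abs_self a]),
    eventually_mul_add_mul_add_le (m := m) hn hc (d₁ := 0) (d₂ := -((|a| + 1) / (1 - c)))
      (b := -a) 0 (by linarith [le_abs_self a])] with k hk₀ hk₁ hk₂
  set E := Real.exp (-(((n k : ℕ) : ℝ) + ((m k : ℕ) : ℝ)) * a) with hE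
  have hE0 : 0 < E := Real.exp_pos _
  have g₁ : μ {ω | empiricalMeasure (n k) (fun i => x i ω) ∉ K₁} ≤ ENNReal.ofReal (C₁ * E) := by
    refine (h₁ hx hx_indep (n k)).trans (ENNReal.ofReal_le_ofReal ?_)
    exact mul_le_mul_of_nonneg_left (Real.exp_le_exp.2 (by linarith)) hC₁
  have g₂ : μ {ω | empiricalMeasure (m k) (fun i => y i ω) ∉ K₂} ≤ ENNReal.ofReal (C₂ * E) := by
    refine (h₂ hy hy_indep (m k)).trans (ENNReal.ofReal_le_ofReal ?_)
    exact mul_le_mul_of_nonneg_left (Real.exp_le_exp.2 (by linarith)) hC₂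
  rw [add_mul, add_mul, ENNReal.ofReal_add (by positivity) (by positivity),
    ENNReal.ofReal_add (by positivity) (by positivity)]
  refine le_trans (measure_mono fun ω hω => ?_) ((measure_union_le _ _).trans
    (add_le_add ((measure_union_le _ _).trans (add_le_add hk₀ g₁)) g₂))
  by_cases m₁ : empiricalMeasure (n k) (fun i => x i ω) ∈ K₁
  · by_cases m₂ : empiricalMeasure (m k) (fun i => y i ω) ∈ K₂
    · exact Or.inl (Or.inl ⟨⟨m₁, m₂⟩, subset_closure hω⟩)
    · exact Or.inr m₂
  · exact Or.inl (Or.inr m₁)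

/-- The lower bound on probabilities in the two-sample Sanov theorem. -/
lemma eventually_le_measure_empiricalMeasure_mem
    (hx : ∀ i, HasLaw (x i) (P : Measure X) μ) (hy : ∀ i, HasLaw (y i) (Q : Measure X) μ)
    (hx_indep : iIndepFun x μ) (hy_indep : iIndepFun y μ)
    (hxy : IndepFun (fun ω i => x i ω) (fun ω i => y i ω) μ)
    (hn : Tendsto (fun k => (n k : ℕ)) l atTop) (hm : Tendsto (fun k => (m k : ℕ)) l atTop)
    (hc0 : 0 < c) (hc1 : c < 1)
    (hc : Tendsto (fun k => ((n k : ℕ) : ℝ) / (((n k : ℕ) : ℝ) + ((m k : ℕ) : ℝ))) l (𝓝 c))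
    {Γ : Set (ProbabilityMeasure X × ProbabilityMeasure X)}
    {p : ProbabilityMeasure X × ProbabilityMeasure X} (hp : p ∈ interior Γ) {b : ℝ}
    (hb : ((pairRate c P Q p : ℝ≥0∞) : EReal) < b) :
    ∀ᶠ k in l, ENNReal.ofReal (Real.exp (-(((n k : ℕ) : ℝ) + ((m k : ℕ) : ℝ)) * b))
      ≤ μ {ω | (empiricalMeasure (n k) (fun i => x i ω),
        empiricalMeasure (m k) (fun i => y i ω)) ∈ Γ} := by
  have hne : pairRate c P Q p ≠ ∞ := fun h => by simp [h] at hb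
  rw [coe_pairRate_eq_toReal hne, EReal.coe_lt_coe_iff, toReal_pairRate hc0 hc1 hne] at hb
  obtain ⟨hkl₁, hkl₂⟩ := klDiv_ne_top_of_pairRate_ne_top hc0 hc1 hne
  obtain ⟨U, hU, V, hV, hUV⟩ := mem_nhds_prod_iff.1 (mem_interior_iff_mem_nhds.1 hp)
  set D₁ := (klDiv (p.1 : Measure X) (P : Measure X)).toReal with hD₁
  set D₂ := (klDiv (p.2 : Measure X) (Q : Measure X)).toReal with hD₂
  set ε : ℝ := (b - (c * D₁ + (1 - c) * D₂)) / 2 with hε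
  have hε0 : 0 < ε := by rw [hε]; linarith
  obtain ⟨A, hAm, hAU, hA⟩ := exists_measurableSet_infinitePi_ge P p.1 hkl₁ hU
    (d := D₁ + ε) (by linarith)
  obtain ⟨B, hBm, hBV, hB⟩ := exists_measurableSet_infinitePi_ge Q p.2 hkl₂ hV
    (d := D₂ + ε) (by linarith)
  -- The term `log 4` pays for the two factors `1 / 2` of the single-sample bounds.
  filter_upwards [hn.eventually hA, hm.eventually hB,
    eventually_mul_add_mul_add_le (m := m) hn hc (d₁ := D₁ + ε) (d₂ := D₂ + ε) (b := b)
      (Real.log 4) (by linarith)] with k hk₁ hk₂ hk₃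
  rw [← measure_preimage_sequence_eq_infinitePi hx hx_indep (hAm _)] at hk₁
  rw [← measure_preimage_sequence_eq_infinitePi hy hy_indep (hBm _)] at hk₂
  calc ENNReal.ofReal (Real.exp (-(((n k : ℕ) : ℝ) + ((m k : ℕ) : ℝ)) * b))
      ≤ ENNReal.ofReal (Real.exp (-((n k : ℕ) : ℝ) * (D₁ + ε)) / 2)
        * ENNReal.ofReal (Real.exp (-((m k : ℕ) : ℝ) * (D₂ + ε)) / 2) := by
        rw [← ENNReal.ofReal_mul (by positivity)]
        refine ENNReal.ofReal_le_ofReal ?_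
        have h4 : Real.exp (-((n k : ℕ) : ℝ) * (D₁ + ε)) / 2
            * (Real.exp (-((m k : ℕ) : ℝ) * (D₂ + ε)) / 2)
            = Real.exp (-((n k : ℕ) : ℝ) * (D₁ + ε) + -((m k : ℕ) : ℝ) * (D₂ + ε)
              - Real.log 4) := by
          rw [Real.exp_sub, Real.exp_add, Real.exp_log (by norm_num)]; ring
        rw [h4]
        exact Real.exp_le_exp.2 (by linarith)
    _ ≤ μ ((fun ω i => x i ω) ⁻¹' A (n k)) * μ ((fun ω i => y i ω) ⁻¹' B (m k)) :=
        mul_le_mul' hk₁ hk₂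
    _ = μ ((fun ω i => x i ω) ⁻¹' A (n k) ∩ (fun ω i => y i ω) ⁻¹' B (m k)) :=
        (hxy.measure_inter_preimage_eq_mul _ _ (hAm _) (hBm _)).symm
    _ ≤ _ := measure_mono fun ω hω => hUV ⟨hAU _ _ hω.1, hBV _ _ hω.2⟩

end TwoSample

/-! ### Passage to upper and lower limits -/

theorem mainTheorem2 {X : Type*} [TopologicalSpace X] [PolishSpace X] [MeasurableSpace X]
    [BorelSpace X] (P Q : ProbabilityMeasure X)
    {Ω : Type*} [MeasurableSpace Ω] (μ : Measure Ω) [IsProbabilityMeasure μ]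
    (x y : ℕ → Ω → X)
    (hx : ∀ i, HasLaw (x i) (P : Measure X) μ) (hy : ∀ i, HasLaw (y i) (Q : Measure X) μ)
    (hx_indep : iIndepFun x μ) (hy_indep : iIndepFun y μ)
    (hxy : IndepFun (fun ω i => x i ω) (fun ω i => y i ω) μ)
    {ι : Type*} (l : Filter ι) (n m : ι → ℕ+)
    (hn : Tendsto (fun k => (n k : ℕ)) l atTop) (hm : Tendsto (fun k => (m k : ℕ)) l atTop)
    (c : ℝ) (hc0 : 0 < c) (hc1 : c < 1)
    (hc : Tendsto (fun k => ((n k : ℕ) : ℝ) / (((n k : ℕ) : ℝ) + ((m k : ℕ) : ℝ))) l (𝓝 c))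
    (Γ : Set (ProbabilityMeasure X × ProbabilityMeasure X)) :
    limsup (fun k => empiricalExponent μ x y Γ (n k) (m k)) l
        ≤ (⨅ p ∈ interior Γ, ((pairRate c P Q p : ℝ≥0∞) : EReal)) ∧
      (⨅ p ∈ closure Γ, ((pairRate c P Q p : ℝ≥0∞) : EReal))
        ≤ liminf (fun k => empiricalExponent μ x y Γ (n k) (m k)) l := by
  constructor
  · refine le_iInf₂ fun p hp => EReal.le_of_forall_lt_iff_le.1 fun b hb => ?_
    exact limsup_le_of_le (by isBoundedDefault)
      ((eventually_le_measure_empiricalMeasure_mem hx hy hx_indep hy_indep hxy hn hm hc0 hc1 hc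
        hp hb).mono fun k hk => empiricalExponent_le hk)
  · refine EReal.ge_of_forall_gt_iff_ge.1 fun a ha => ?_
    -- The gap between `a` and `a'` absorbs the constant `C ≤ exp C`, because `n + m → ∞`.
    obtain ⟨a', haa', ha'⟩ := EReal.lt_iff_exists_real_btwn.1 ha
    rw [EReal.coe_lt_coe_iff] at haa'
    obtain ⟨C, hC, h⟩ := eventually_measure_empiricalMeasure_mem_le hx hy hx_indep hy_indep hxy
      hn hc0 hc1 hc (Γ := Γ) (a := a') fun p hp => ha'.trans_le (iInf₂_le p hp)
    refine le_liminf_of_le (by isBoundedDefault) ?_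
    filter_upwards [h, eventually_mul_add_mul_add_le (m := m) hn hc (d₁ := a) (d₂ := a) (b := a')
      C (by linarith)] with k hk hk'
    refine le_empiricalExponent (hk.trans (ENNReal.ofReal_le_ofReal ?_))
    calc C * Real.exp (-(((n k : ℕ) : ℝ) + ((m k : ℕ) : ℝ)) * a')
        ≤ Real.exp C * Real.exp (-(((n k : ℕ) : ℝ) + ((m k : ℕ) : ℝ)) * a') := by
          gcongr
          linarith [Real.add_one_le_exp C]
      _ ≤ Real.exp (-(((n k : ℕ) : ℝ) + ((m k : ℕ) : ℝ)) * a) := by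
          rw [← Real.exp_add]
          exact Real.exp_le_exp.2 (by linarith)
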